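/- **Theorem 2.1 (Sum rules for arbitrarily many Bessel factors).** For $t>0$ let $I_0(t)=\frac1\pi\int_0^\pi e^{t\cos\theta}\,d\theta$ and $K_0(t)=\int_0^\infty e^{-t\cosh u}\,du$ be the modified Bessel functions of order zero, and for integers $0\le a<b$ and $k\ge 0$ let $$\mathbf{IKM}(a,b;2k+1)=\int_0^\infty I_0(t)^a K_0(t)^b\, t^{2k+1}\,dt,$$ which is an absolutely convergent integral. For every integer $n\ge 1$ there is a nonzero polynomial $f_n(\xi)\in\frac{1}{n+4}\mathbb Z[\xi]$ of degree at most $\lfloor (n+1)/2\rfloor$ such that $$\int_0^\infty K_0(t)^{n+2}\, t\, f_n(t^2)\,dt=(n+1)!,$$ and such that the same polynomial satisfies, for every integer $a$ with $1\le a<(n+2)/2$, $$\int_0^\infty I_0(t)^a K_0(t)^{n+2-a}\, t\, f_n(t^2)\,dt=0,$$ all these integrals being absolutely convergent. As a result, the following hold. (i) For all integers $1\le a<b$, the numbers $\mathbf{IKM}(a,b;2k+1)$, $0\le k\le \lfloor (a+b-1)/2\rfloor$, are linearly dependent over $\mathbb Q$ (as a family indexed by $k$), and $$\dim_{\mathbb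 Q}\operatorname{span}_{\mathbb Q}\{\mathbf{IKM}(a,b;2k+1): k\in\mathbb Z_{\ge0}\}\le\lfloor (a+b-1)/2\rfloor.$$ (ii) For every integer $n\ge 2$, the number $1$ together with the numbers $\mathbf{IKM}(0,n;2k+1)$, $0\le k\le \lfloor (n-1)/2\rfloor$, are linearly dependent over $\mathbb Q$ (as a family), and $$\dim_{\mathbb Q}\operatorname{span}_{\mathbb Q}\{\mathbf{IKM}(0,n;2k+1): k\in\mathbb Z_{\ge0}\}\le\lfloor (n+1)/2\rfloor.$$ -/

import Mathlib

/-- The modified Bessel function of the first kind of order zero,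
`I₀(t) = (1/π) ∫_0^π exp(t cos θ) dθ`. -/
noncomputable def besselI0 (t : ℝ) : ℝ :=
  (1 / Real.pi) * ∫ θ in (0 : ℝ)..Real.pi, Real.exp (t * Real.cos θ)

/-- The modified Bessel function of the second kind of order zero,
`K₀(t) = ∫_0^∞ exp(-t cosh u) du`, used for `t > 0`. -/
noncomputable def besselK0 (t : ℝ) : ℝ :=
  ∫ u in Set.Ioi (0 : ℝ), Real.exp (-(t * Real.cosh u))

/-- The Bessel moment `IKM(a,b;m) = ∫_0^∞ I₀(t)^a K₀(t)^b t^m dt`. -/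
noncomputable def IKM (a b m : ℕ) : ℝ :=
  ∫ t in Set.Ioi (0 : ℝ), besselI0 t ^ a * besselK0 t ^ b * t ^ m

/-! Write θ = t d/dt. Any solution W of the Bessel equation, with V = θW, satisfies θV = t²W, so θ
preserves the module of forms of degree m in W and V over the polynomials in t². Take F = ∑_{j ≤ m}
R_j(t²)/j! · W^j V^{m-j}. Requiring the coefficients of W^j V^{m-j}, j < m, in F' to vanish is the
three-term recursion of `adjointPoly`, and what remains is F' = -R_{m+1}(t²)/(t · m!) · W^m. Since X
divides R_{m+1}, this is t times a polynomial in t² (`sumRulePoly`) times W^m, up to a constant.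

Apply this to W = K₀ + X I₀ with X formal: the coefficient of X^a in W^m is a binomial coefficient
times I₀^a K₀^{m-a}, so one polynomial serves all a. For 2a < m that coefficient of F decays at
infinity. At 0 every term with j ≥ 1 carries a factor t² against at most logarithmic growth, and the
term j = 0 tends to a nonzero limit only if k = 0 and a = 0, because θK₀ → -1 and θI₀ → 0. Hence
`integral_sumRulePoly`: the integral is (-1)^m m! in that case and 0 otherwise. For k = 0 the
polynomial is divisible by m, which turns m! into (m-1)!.

Starting from R_0 = X^k gives a relation of exact degree k + ⌊(m-1)/2⌋ for every k, as the top
coefficients alternate in sign and cannot cancel. Higher moments therefore reduce to the first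
⌊(m-1)/2⌋ of them, together with 1 when a = 0; this yields the dependences and dimension bounds. -/

/-! ### The adjoint recursion: degrees, signs, divisibility -/

open Polynomial in
/-- The polynomials `R j` produced by transposing the symmetric `m`-th power of the Bessel equation,
written in the variable `X = t ^ 2`, started at `X ^ k`. -/
noncomputable def adjointPoly (m k : ℕ) : ℕ → ℤ[X]
  | 0 => X ^ k
  | 1 => X * (-2 * derivative (X ^ k))
  | j + 2 => X * -(2 * derivative (adjointPoly m k (j + 1)) +
      C (((m : ℤ) - j) * (j + 1)) * adjointPoly m k j)

open Polynomial in
theorem adjointPoly_add_two (m k j : ℕ) : adjointPoly m k (j + 2) =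
    X * -(2 * derivative (adjointPoly m k (j + 1)) +
      C (((m : ℤ) - j) * (j + 1)) * adjointPoly m k j) := by
  rw [adjointPoly]

open Polynomial in
theorem X_dvd_adjointPoly (m k j : ℕ) : X ∣ adjointPoly m k (j + 1) := by
  cases j with
  | zero => rw [adjointPoly]; exact dvd_mul_right _ _
  | succ j => rw [adjointPoly]; exact dvd_mul_right _ _

open Polynomial in
theorem natDegree_adjointPoly_le (m k : ℕ) :
    ∀ j, (adjointPoly m k j).natDegree ≤ k + j / 2
  | 0 => by rw [adjointPoly]; exact natDegree_X_pow_le _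
  | 1 => by
    rw [adjointPoly, natDegree_le_iff_coeff_eq_zero]
    intro N hN
    obtain ⟨N, rfl⟩ : ∃ M, N = M + 1 := ⟨N - 1, by omega⟩
    rw [coeff_X_mul, show (-2 : ℤ[X]) = C (-2) by simp, coeff_C_mul, coeff_derivative,
      coeff_X_pow, if_neg (by omega)]
    simp
  | j + 2 => by
    have h1 := natDegree_adjointPoly_le m k (j + 1)
    have h0 := natDegree_adjointPoly_le m k j
    rw [adjointPoly, natDegree_le_iff_coeff_eq_zero]
    intro N hN
    obtain ⟨N, rfl⟩ : ∃ M, N = M + 1 := ⟨N - 1, by omega⟩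
    rw [coeff_X_mul, show (2 : ℤ[X]) = C 2 by simp, coeff_neg, coeff_add, coeff_C_mul, coeff_C_mul,
      coeff_derivative, coeff_eq_zero_of_natDegree_lt (lt_of_le_of_lt h1 (by omega)),
      coeff_eq_zero_of_natDegree_lt (lt_of_le_of_lt h0 (by omega))]
    simp

-- Up to index m + 1 the factors m - j in the recursion are nonnegative, so both contributions to a
-- top coefficient have the same sign. The odd case is only weakly signed in general because R_1 = 0
-- when k = 0.
open Polynomial in
theorem adjointPoly_coeff_pos (m k : ℕ) : ∀ i, 2 * i ≤ m + 1 →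
    0 < (-1) ^ i * (adjointPoly m k (2 * i)).coeff (k + i) ∧
    0 ≤ (-1) ^ (i + 1) * (adjointPoly m k (2 * i + 1)).coeff (k + i) ∧
    (1 ≤ k + i → 0 < (-1) ^ (i + 1) * (adjointPoly m k (2 * i + 1)).coeff (k + i))
  | 0, _ => by
    rw [adjointPoly, adjointPoly]
    rcases k with _ | k
    · simp
    · simp only [add_zero, coeff_X_mul, show (-2 : ℤ[X]) = C (-2) by simp, coeff_C_mul,
        coeff_derivative, coeff_X_pow]
      simp
      omega
  | i + 1, hi => by
    obtain ⟨h0, h1, -⟩ := adjointPoly_coeff_pos m k i (by omega)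
    have e0 : (adjointPoly m k (2 * (i + 1))).coeff (k + (i + 1)) =
        -(((m : ℤ) - 2 * i) * (2 * i + 1) * (adjointPoly m k (2 * i)).coeff (k + i)) := by
      rw [show 2 * (i + 1) = 2 * i + 2 by ring, adjointPoly_add_two, ← add_assoc, coeff_X_mul,
        show (2 : ℤ[X]) = C 2 by simp, coeff_neg, coeff_add, coeff_C_mul, coeff_C_mul,
        coeff_derivative, coeff_eq_zero_of_natDegree_lt
          (lt_of_le_of_lt (natDegree_adjointPoly_le m k (2 * i + 1)) (by omega))]
      push_cast
      ring
    have e1 : (adjointPoly m k (2 * (i + 1) + 1)).coeff (k + (i + 1)) =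
        -(2 * ((k : ℤ) + i + 1) * (adjointPoly m k (2 * (i + 1))).coeff (k + (i + 1)) +
          ((m : ℤ) - (2 * i + 1)) * (2 * i + 2) *
            (adjointPoly m k (2 * i + 1)).coeff (k + i)) := by
      rw [show 2 * (i + 1) + 1 = 2 * i + 1 + 2 by ring, adjointPoly_add_two, ← add_assoc,
        coeff_X_mul, show (2 : ℤ[X]) = C 2 by simp, coeff_neg, coeff_add, coeff_C_mul, coeff_C_mul,
        coeff_derivative]
      push_cast
      rw [show 2 * (i + 1) = 2 * i + 1 + 1 by ring]
      ring
    have p0 : 0 < (-1) ^ (i + 1) * (adjointPoly m k (2 * (i + 1))).coeff (k + (i + 1)) := by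
      rw [e0]
      have : 0 < ((m : ℤ) - 2 * i) * (2 * i + 1) := by
        apply mul_pos <;> omega
      have := mul_pos this h0
      rw [pow_succ]
      linarith
    have p1 : 0 < (-1) ^ (i + 1 + 1) *
        (adjointPoly m k (2 * (i + 1) + 1)).coeff (k + (i + 1)) := by
      rw [e1]
      have a1 : 0 < 2 * ((k : ℤ) + i + 1) := by omega
      have a2 : 0 ≤ ((m : ℤ) - (2 * i + 1)) * (2 * i + 2) := by
        apply mul_nonneg <;> omega
      have := mul_pos a1 p0
      have := mul_nonneg a2 h1
      rw [pow_succ _ (i + 1)]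
      linarith
    exact ⟨p0, p1.le, fun _ => p1⟩

open Polynomial in
/-- The polynomial occurring in the sum rule, without its factor `X`. -/
noncomputable def sumRulePoly (m k : ℕ) : ℤ[X] := (adjointPoly m k (m + 1)).divX

open Polynomial in
theorem X_mul_sumRulePoly (m k : ℕ) : X * sumRulePoly m k = adjointPoly m k (m + 1) := by
  obtain ⟨p, hp⟩ := X_dvd_adjointPoly m k m
  have h := divX_mul_X_add (adjointPoly m k (m + 1))
  rw [show (adjointPoly m k (m + 1)).coeff 0 = 0 by rw [hp, mul_coeff_zero]; simp, C_0,
    add_zero] at h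
  rw [sumRulePoly, mul_comm, h]

open Polynomial in
theorem sumRulePoly_coeff_ne_zero {m : ℕ} (hm : 2 ≤ m) (k : ℕ) :
    (sumRulePoly m k).coeff (k + (m - 1) / 2) ≠ 0 := by
  have hd : (m + 1) / 2 = (m - 1) / 2 + 1 := by omega
  rw [sumRulePoly, coeff_divX, add_assoc, ← hd]
  intro h
  rcases Nat.even_or_odd' m with ⟨i, rfl | rfl⟩
  · have := (adjointPoly_coeff_pos (2 * i) k i (by omega)).2.2 (by omega)
    rw [show (2 * i + 1) / 2 = i by omega] at h
    simp [h] at this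
  · have := (adjointPoly_coeff_pos (2 * i + 1) k (i + 1) (by omega)).1
    rw [show (2 * i + 1 + 1) / 2 = i + 1 by omega, show 2 * i + 1 + 1 = 2 * (i + 1) by ring] at h
    simp [h] at this

theorem sumRulePoly_ne_zero {m : ℕ} (hm : 2 ≤ m) (k : ℕ) : sumRulePoly m k ≠ 0 := fun h =>
  sumRulePoly_coeff_ne_zero hm k (by rw [h, Polynomial.coeff_zero])

open Polynomial in
theorem natDegree_sumRulePoly {m : ℕ} (hm : 2 ≤ m) (k : ℕ) :
    (sumRulePoly m k).natDegree = k + (m - 1) / 2 := by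
  refine le_antisymm ?_ (le_natDegree_of_ne_zero (sumRulePoly_coeff_ne_zero hm k))
  rw [sumRulePoly, natDegree_divX_eq_natDegree_tsub_one]
  have := natDegree_adjointPoly_le m k (m + 1)
  omega

-- For k = 0 the derivative kills R_0 = 1, so R_1 = 0 and R_2 = -mX; the recursion then propagates
-- the factor m.
open Polynomial in
theorem C_dvd_adjointPoly (m : ℕ) : ∀ j, C (m : ℤ) ∣ adjointPoly m 0 (j + 1)
  | 0 => by rw [adjointPoly]; simp
  | 1 => by
    rw [adjointPoly, zero_add, adjointPoly, adjointPoly]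
    simp
  | j + 2 => by
    obtain ⟨p, hp⟩ := C_dvd_adjointPoly m (j + 1)
    obtain ⟨q, hq⟩ := C_dvd_adjointPoly m j
    rw [adjointPoly_add_two, hp, hq, derivative_C_mul]
    exact ⟨X * -(2 * derivative p + C (((m : ℤ) - (j + 1 : ℕ)) * ((j + 1 : ℕ) + 1)) * q), by ring⟩

open Polynomial in
theorem C_dvd_sumRulePoly (m : ℕ) : C (m : ℤ) ∣ sumRulePoly m 0 := by
  rw [C_dvd_iff_dvd_coeff]
  intro i
  rw [sumRulePoly, coeff_divX]
  exact (C_dvd_iff_dvd_coeff _ _).1 (C_dvd_adjointPoly m m) _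

/-! ### Growth rates up to ε, for functions and for polynomial coefficients -/

open Filter Asymptotics Topology in
/-- `f` grows at most like `h ^ (c + ε)` along `l`, for every `ε > 0`. -/
def GrowthLE (l : Filter ℝ) (h : ℝ → ℝ) (c : ℝ) (f : ℝ → ℝ) : Prop :=
  ∀ ε : ℝ, 0 < ε → f =O[l] fun t => h t ^ (c + ε)

open Filter Asymptotics Topology in
theorem GrowthLE.zero (l : Filter ℝ) (h : ℝ → ℝ) (c : ℝ) : GrowthLE l h c fun _ => 0 :=
  fun _ _ => isBigO_zero _ _

open Filter Asymptotics Topology in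
theorem GrowthLE.add {l : Filter ℝ} {h : ℝ → ℝ} {c : ℝ} {f g : ℝ → ℝ}
    (hf : GrowthLE l h c f) (hg : GrowthLE l h c g) : GrowthLE l h c fun t => f t + g t :=
  fun ε hε => (hf ε hε).add (hg ε hε)

open Filter Asymptotics Topology in
theorem GrowthLE.sum {ι : Type*} {l : Filter ℝ} {h : ℝ → ℝ} {c : ℝ} {f : ι → ℝ → ℝ}
    (s : Finset ι) (hf : ∀ i ∈ s, GrowthLE l h c (f i)) :
    GrowthLE l h c fun t => ∑ i ∈ s, f i t :=
  fun ε hε => IsBigO.fun_sum fun i hi => hf i hi ε hε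

open Filter Asymptotics Topology in
theorem GrowthLE.mul {l : Filter ℝ} {h : ℝ → ℝ} (hh : ∀ᶠ t in l, 0 < h t) {c d : ℝ}
    {f g : ℝ → ℝ} (hf : GrowthLE l h c f) (hg : GrowthLE l h d g) :
    GrowthLE l h (c + d) fun t => f t * g t := fun ε hε =>
  ((hf (ε / 2) (half_pos hε)).mul (hg (ε / 2) (half_pos hε))).congr' (Eventually.of_forall
    fun _ => rfl) (hh.mono fun t ht => by
      dsimp only
      rw [← Real.rpow_add ht]; congr 1; ring)

open Filter Asymptotics Topology in
theorem GrowthLE.const {l : Filter ℝ} {h : ℝ → ℝ} (hh : ∀ᶠ t in l, 1 ≤ h t) (C : ℝ) :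
    GrowthLE l h 0 fun _ => C := fun ε hε => by
  apply IsBigO.of_bound |C|
  filter_upwards [hh] with t ht
  rw [zero_add, Real.norm_eq_abs, Real.norm_eq_abs]
  have h1 : 1 ≤ h t ^ ε := Real.one_le_rpow ht hε.le
  rw [abs_of_nonneg (zero_le_one.trans h1)]
  exact le_mul_of_one_le_right (abs_nonneg _) h1

open Filter Asymptotics Topology in
theorem GrowthLE.pow {l : Filter ℝ} {h : ℝ → ℝ} (hh : ∀ᶠ t in l, 1 ≤ h t) {c : ℝ}
    {f : ℝ → ℝ} (hf : GrowthLE l h c f) : ∀ n : ℕ, GrowthLE l h (n * c) fun t => f t ^ n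
  | 0 => by simpa using GrowthLE.const hh 1
  | n + 1 => by
    have := (GrowthLE.pow hh hf n).mul (hh.mono fun t ht => by linarith) hf
    simp only [pow_succ]
    convert! this using 1
    push_cast; ring

open Filter Asymptotics Topology in
theorem GrowthLE.of_isBigO {l : Filter ℝ} {h : ℝ → ℝ} (hh : ∀ᶠ t in l, 1 ≤ h t) {c : ℝ}
    {f : ℝ → ℝ} (hf : f =O[l] fun t => h t ^ c) : GrowthLE l h c f := fun ε hε => by
  refine hf.trans (IsBigO.of_bound 1 ?_)
  filter_upwards [hh] with t ht
  rw [one_mul, Real.norm_of_nonneg (Real.rpow_nonneg (by linarith) _),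
    Real.norm_of_nonneg (Real.rpow_nonneg (by linarith) _)]
  exact Real.rpow_le_rpow_of_exponent_le ht (by linarith)

open Filter Asymptotics Topology in
theorem GrowthLE.aeval {l : Filter ℝ} {h : ℝ → ℝ} (hh : ∀ᶠ t in l, 1 ≤ h t)
    {f : ℝ → ℝ} (hf : GrowthLE l h 0 f) {R : Type*} [CommRing R] [Algebra R ℝ]
    (p : Polynomial R) : GrowthLE l h 0 fun t => Polynomial.aeval (f t) p := by
  have hh' : ∀ᶠ t in l, 0 < h t := hh.mono fun t ht => by linarith
  induction p using Polynomial.induction_on' with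
  | add p q hp hq => simpa using hp.add hq
  | monomial n a =>
    simp only [Polynomial.aeval_monomial]
    simpa using (GrowthLE.const hh (algebraMap R ℝ a)).mul hh' (hf.pow hh n)

/-- Coefficientwise version of `GrowthLE`, the rate of the `a`-th coefficient being
`σ * a + c`. -/
def PolyGrowthLE (l : Filter ℝ) (h : ℝ → ℝ) (σ c : ℝ) (P : ℝ → Polynomial ℝ) : Prop :=
  ∀ a : ℕ, GrowthLE l h (σ * a + c) fun t => (P t).coeff a

open Filter in
theorem PolyGrowthLE.mul {l : Filter ℝ} {h : ℝ → ℝ} (hh : ∀ᶠ t in l, 0 < h t) {σ c d : ℝ}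
    {P Q : ℝ → Polynomial ℝ} (hP : PolyGrowthLE l h σ c P) (hQ : PolyGrowthLE l h σ d Q) :
    PolyGrowthLE l h σ (c + d) fun t => P t * Q t := fun a => by
  simp only [Polynomial.coeff_mul]
  refine GrowthLE.sum _ fun x hx => ?_
  rw [Finset.HasAntidiagonal.mem_antidiagonal] at hx
  convert! (hP x.1).mul hh (hQ x.2) using 1
  rw [← hx]; push_cast; ring

open Filter in
theorem PolyGrowthLE.one {l : Filter ℝ} {h : ℝ → ℝ} (hh : ∀ᶠ t in l, 1 ≤ h t) (σ : ℝ) :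
    PolyGrowthLE l h σ 0 fun _ => 1 := fun a => by
  simp only [Polynomial.coeff_one]
  rcases a with _ | a
  · simpa using GrowthLE.const hh 1
  · simpa using GrowthLE.zero l h _

open Filter in
theorem PolyGrowthLE.pow {l : Filter ℝ} {h : ℝ → ℝ} (hh : ∀ᶠ t in l, 1 ≤ h t) {σ c : ℝ}
    {P : ℝ → Polynomial ℝ} (hP : PolyGrowthLE l h σ c P) :
    ∀ n : ℕ, PolyGrowthLE l h σ (n * c) fun t => P t ^ n
  | 0 => by simpa using PolyGrowthLE.one hh σ
  | n + 1 => by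
    have := (PolyGrowthLE.pow hh hP n).mul (hh.mono fun t ht => by linarith) hP
    simp only [pow_succ]
    convert! this using 1
    push_cast; ring

open Polynomial in
theorem PolyGrowthLE.linear {l : Filter ℝ} {h : ℝ → ℝ} {σ c : ℝ} {f g : ℝ → ℝ}
    (hf : GrowthLE l h c f) (hg : GrowthLE l h (σ + c) g) :
    PolyGrowthLE l h σ c fun t => C (f t) + C (g t) * X
  | 0 => by simpa using hf
  | 1 => by simpa [coeff_C] using hg
  | a + 2 => by simpa [coeff_C, coeff_X] using GrowthLE.zero l h _

/-! ### Coefficientwise calculus and the telescoping primitive -/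

/-- Coefficientwise derivative of a polynomial-valued function. -/
def HasPolyDerivAt (P : ℝ → Polynomial ℝ) (P' : Polynomial ℝ) (t : ℝ) : Prop :=
  ∀ a : ℕ, HasDerivAt (fun s => (P s).coeff a) (P'.coeff a) t

theorem HasPolyDerivAt.add {P Q : ℝ → Polynomial ℝ} {P' Q' : Polynomial ℝ} {t : ℝ}
    (hP : HasPolyDerivAt P P' t) (hQ : HasPolyDerivAt Q Q' t) :
    HasPolyDerivAt (fun s => P s + Q s) (P' + Q') t := fun a => by
  simpa using! (hP a).add (hQ a)

theorem HasPolyDerivAt.mul {P Q : ℝ → Polynomial ℝ} {P' Q' : Polynomial ℝ} {t : ℝ}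
    (hP : HasPolyDerivAt P P' t) (hQ : HasPolyDerivAt Q Q' t) :
    HasPolyDerivAt (fun s => P s * Q s) (P' * Q t + P t * Q') t := fun a => by
  simp only [Polynomial.coeff_mul, Polynomial.coeff_add, ← Finset.sum_add_distrib]
  exact HasDerivAt.fun_sum fun x _ => (hP x.1).mul (hQ x.2)

theorem HasPolyDerivAt.pow {P : ℝ → Polynomial ℝ} {P' : Polynomial ℝ} {t : ℝ}
    (hP : HasPolyDerivAt P P' t) :
    ∀ n : ℕ, HasPolyDerivAt (fun s => P s ^ n) (n * P t ^ (n - 1) * P') t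
  | 0 => fun a => by simpa using hasDerivAt_const t _
  | n + 1 => by
    have := (HasPolyDerivAt.pow hP n).mul hP
    simp only [pow_succ]
    convert! this using 1
    rcases n with _ | n
    · simp
    · simp only [Nat.add_sub_cancel, pow_succ]; push_cast; ring

open Polynomial in
theorem HasPolyDerivAt.const_C {f : ℝ → ℝ} {f' t : ℝ} (hf : HasDerivAt f f' t) :
    HasPolyDerivAt (fun s => C (f s)) (C f') t
  | 0 => by simpa using hf
  | a + 1 => by simpa [coeff_C] using hasDerivAt_const t _

open Polynomial in
theorem HasPolyDerivAt.linear {f g : ℝ → ℝ} {f' g' t : ℝ} (hf : HasDerivAt f f' t)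
    (hg : HasDerivAt g g' t) :
    HasPolyDerivAt (fun s => C (f s) + C (g s) * X) (C f' + C g' * X) t
  | 0 => by simpa using hf
  | 1 => by simpa [coeff_C] using hg
  | a + 2 => by simpa [coeff_C, coeff_X] using hasDerivAt_const t (0 : ℝ)

open Filter Topology in
theorem tendsto_coeff_pow {l : Filter ℝ} {P : ℝ → Polynomial ℝ} {Q : Polynomial ℝ}
    (h : ∀ a, Tendsto (fun t => (P t).coeff a) l (𝓝 (Q.coeff a))) :
    ∀ n a : ℕ, Tendsto (fun t => (P t ^ n).coeff a) l (𝓝 ((Q ^ n).coeff a))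
  | 0, a => by simpa using tendsto_const_nhds
  | n + 1, a => by
    simp only [pow_succ, Polynomial.coeff_mul]
    exact tendsto_finsetSum _ fun x _ => (tendsto_coeff_pow h n x.1).mul (h x.2)

open Polynomial in
/-- Primitive, up to the factor `t`, of `W ^ m` times the polynomial of the sum rule: here
`W' = V / t` and `V' = t * W`. -/
noncomputable def sumRulePrimitive (m k : ℕ) (W V : ℝ → ℝ[X]) (M : ℕ) (t : ℝ) : ℝ[X] :=
  ∑ j ∈ Finset.range (M + 1),
    C (aeval (t ^ 2) (adjointPoly m k j) / (Nat.factorial j : ℝ)) * (W t ^ j * V t ^ (m - j))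

open Polynomial in
theorem hasDerivAt_aeval_sq (p : ℤ[X]) (t : ℝ) :
    HasDerivAt (fun s : ℝ => aeval (s ^ 2) p) (aeval (t ^ 2) (derivative p) * (2 * t)) t := by
  have := (p.hasDerivAt_aeval (t ^ 2)).comp t (hasDerivAt_pow 2 t)
  simpa using! this

open Polynomial in
theorem hasPolyDerivAt_term {m j : ℕ} (hj : j ≤ m) {W V : ℝ → ℝ[X]} {t : ℝ}
    (hW : HasPolyDerivAt W (C t⁻¹ * V t) t) (hV : HasPolyDerivAt V (C t * W t) t)
    (p : ℤ[X]) (c : ℝ) :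
    HasPolyDerivAt (fun s => C (aeval (s ^ 2) p / c) * (W s ^ j * V s ^ (m - j)))
      (C (aeval (t ^ 2) (derivative p) * (2 * t) / c) * (W t ^ j * V t ^ (m - j)) +
        C (aeval (t ^ 2) p / c) * (C (j * t⁻¹) * W t ^ (j - 1) * V t ^ (m - j + 1) +
          C (((m : ℝ) - j) * t) * W t ^ (j + 1) * V t ^ (m - j - 1))) t := by
  have h := (HasPolyDerivAt.const_C ((hasDerivAt_aeval_sq p t).div_const c)).mul
    ((hW.pow j).mul (hV.pow (m - j)))
  have e : ((m - j : ℕ) : ℝ[X]) = C ((m : ℝ) - j) := by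
    rw [← Nat.cast_sub hj, ← C_eq_natCast]
  rw [e, ← C_eq_natCast j] at h
  refine Eq.mp (congrArg (fun q => HasPolyDerivAt _ q t) ?_) h
  rw [C_mul (a := (j : ℝ)), C_mul (a := (m : ℝ) - j)]
  ring

-- A partial sum telescopes to its two end terms. At M = m the second has coefficient m - M = 0, so
-- the truncated exponent m - M - 1 is harmless there.
open Polynomial in
theorem hasPolyDerivAt_sumRulePrimitive {m : ℕ} (k : ℕ) {W V : ℝ → ℝ[X]} {t : ℝ} (ht : t ≠ 0)
    (hW : HasPolyDerivAt W (C t⁻¹ * V t) t) (hV : HasPolyDerivAt V (C t * W t) t) :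
    ∀ M ≤ m, HasPolyDerivAt (sumRulePrimitive m k W V M)
      (C (-(t⁻¹ * aeval (t ^ 2) (adjointPoly m k (M + 1)) / (Nat.factorial M : ℝ))) *
          (W t ^ M * V t ^ (m - M)) +
        C (((m : ℝ) - M) * t * aeval (t ^ 2) (adjointPoly m k M) / (Nat.factorial M : ℝ)) *
          (W t ^ (M + 1) * V t ^ (m - M - 1))) t := by
  intro M
  induction M with
  | zero =>
    intro _
    have := hasPolyDerivAt_term (Nat.zero_le m) hW hV (adjointPoly m k 0) 1
    convert! this using 1
    · funext s
      simp [sumRulePrimitive]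
    · have e1 : aeval (t ^ 2) (adjointPoly m k 1) =
          t ^ 2 * (-2 * aeval (t ^ 2) (derivative (adjointPoly m k 0))) := by
        rw [adjointPoly, adjointPoly]; simp [map_ofNat]
      have e2 : -(t⁻¹ * aeval (t ^ 2) (adjointPoly m k 1)) =
          aeval (t ^ 2) (derivative (adjointPoly m k 0)) * (2 * t) := by
        rw [e1]; field_simp
      simp only [zero_add, Nat.factorial_zero, Nat.cast_one, div_one, e2]
      simp
      ring
  | succ M ih =>
    intro hM
    have h1 := ih (by omega)
    have h2 := hasPolyDerivAt_term hM hW hV (adjointPoly m k (M + 1)) (Nat.factorial (M + 1))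
    convert! h1.add h2 using 1
    · funext s
      rw [sumRulePrimitive, Finset.sum_range_succ]
      rfl
    · obtain ⟨r, rfl⟩ : ∃ r, m = M + 1 + r := ⟨m - (M + 1), by omega⟩
      have hf : (Nat.factorial (M + 1) : ℝ) = (M + 1) * Nat.factorial M := by
        rw [Nat.factorial_succ]; push_cast; ring
      have hf0 : (Nat.factorial M : ℝ) ≠ 0 := by positivity
      have hM0 : (M : ℝ) + 1 ≠ 0 := by positivity
      have e1 : aeval (t ^ 2) (adjointPoly (M + 1 + r) k (M + 1 + 1)) = -(t ^ 2 *
          (2 * aeval (t ^ 2) (derivative (adjointPoly (M + 1 + r) k (M + 1))) +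
          ((r : ℝ) + 1) * (M + 1) * aeval (t ^ 2) (adjointPoly (M + 1 + r) k M))) := by
        rw [adjointPoly_add_two]
        simp only [map_mul, map_neg, map_add, aeval_X, map_ofNat, aeval_C]
        simp
        ring
      rw [e1, hf, show M + 1 + r - (M + 1) = r by omega, show M + 1 + r - M = r + 1 by omega]
      set p := aeval (t ^ 2) (derivative (adjointPoly (M + 1 + r) k (M + 1)))
      set q := aeval (t ^ 2) (adjointPoly (M + 1 + r) k (M + 1))
      set u := aeval (t ^ 2) (adjointPoly (M + 1 + r) k M)
      -- `c1` is the recursion, merging the two contributions to W^(M+1) V^(m-M-1); `c2` is the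
      -- cancellation of the W^M V^(m-M) terms.
      have c1 : -(t⁻¹ * -(t ^ 2 * (2 * p + ((r : ℝ) + 1) * (M + 1) * u)) /
            ((M + 1) * Nat.factorial M)) =
          p * (2 * t) / ((M + 1) * Nat.factorial M) + (r + 1) * t * u / Nat.factorial M := by
        field_simp
      have c2 : -(t⁻¹ * q / (Nat.factorial M : ℝ)) =
          -(q / ((M + 1) * Nat.factorial M) * ((M + 1) * t⁻¹)) := by
        field_simp
      have c3 : ((M + 1 + r : ℕ) : ℝ) - (M + 1 : ℕ) = r := by push_cast; ring
      have c4 : ((M + 1 + r : ℕ) : ℝ) - M = r + 1 := by push_cast; ring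
      have c5 : (r : ℝ) * t * q / ((M + 1) * Nat.factorial M) =
          q / ((M + 1) * Nat.factorial M) * (r * t) := by ring
      rw [c1, c2, c3, c4, c5]
      simp only [C_add, C_neg, Nat.add_sub_cancel]
      push_cast
      simp only [C_mul]
      ring

open Filter Asymptotics Topology MeasureTheory in
theorem integrableOn_Ioi_of_growthLE {f : ℝ → ℝ} (hf : ContinuousOn f (Set.Ioi 0)) {c : ℝ}
    (h0 : GrowthLE (𝓝[>] 0) (fun t => t⁻¹) 0 f) (hc : c < 0)
    (h1 : GrowthLE atTop Real.exp c f) : IntegrableOn f (Set.Ioi 0) := by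
  have htop : f =O[atTop] fun t : ℝ => t ^ (-2 : ℝ) := by
    refine (h1 (-c / 2) (by linarith)).trans ?_
    have := (isLittleO_exp_neg_mul_rpow_atTop (show 0 < -c / 2 by linarith) (-2)).isBigO
    refine this.congr_left fun t => ?_
    rw [← Real.exp_mul]; congr 1; ring
  have hbot : f =O[𝓝[>] 0] fun t : ℝ => t ^ (-(1 / 2) : ℝ) := by
    refine (h0 (1 / 2) (by norm_num)).congr' (Eventually.of_forall fun _ => rfl) ?_
    filter_upwards [self_mem_nhdsWithin] with t ht
    rw [Real.inv_rpow (le_of_lt ht), Real.rpow_neg (le_of_lt ht), zero_add]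
  -- At s = 1 the Mellin kernel t^(s-1) is 1; the exponents -2 at infinity and -1/2 at 0 lie on
  -- either side of -1.
  have := mellin_convergent_of_isBigO_scalar (s := 1)
    (hf.locallyIntegrableOn measurableSet_Ioi) htop (by norm_num) hbot (by norm_num)
  simpa using this

/-! ### The function I₀ and its Euler derivative -/

/-- `t` times the derivative of `I₀`. -/
noncomputable def besselI0Euler (t : ℝ) : ℝ :=
  t * ((1 / Real.pi) * ∫ θ in (0 : ℝ)..Real.pi, Real.cos θ * Real.exp (t * Real.cos θ))

theorem abs_integral_cos_pow_mul_exp_le (n : ℕ) {t : ℝ} (ht : 0 ≤ t) :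
    |(1 / Real.pi) * ∫ θ in (0 : ℝ)..Real.pi, Real.cos θ ^ n * Real.exp (t * Real.cos θ)| ≤
      Real.exp t := by
  have h := intervalIntegral.norm_integral_le_of_norm_le_const (a := 0) (b := Real.pi)
    (f := fun θ => Real.cos θ ^ n * Real.exp (t * Real.cos θ)) (C := Real.exp t) fun θ _ => by
      rw [norm_mul, norm_pow, Real.norm_eq_abs, Real.norm_of_nonneg (Real.exp_pos _).le]
      have h1 : |Real.cos θ| ^ n ≤ 1 := pow_le_one₀ (abs_nonneg _) (Real.abs_cos_le_one θ)
      have h2 : Real.exp (t * Real.cos θ) ≤ Real.exp t :=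
        Real.exp_le_exp.2 (mul_le_of_le_one_right ht (Real.cos_le_one θ))
      calc _ ≤ 1 * Real.exp t := mul_le_mul h1 h2 (Real.exp_pos _).le zero_le_one
        _ = _ := one_mul _
  rw [sub_zero, abs_of_pos Real.pi_pos, Real.norm_eq_abs] at h
  rw [abs_mul, abs_of_pos (one_div_pos.2 Real.pi_pos)]
  calc _ ≤ 1 / Real.pi * (Real.exp t * Real.pi) :=
        mul_le_mul_of_nonneg_left h (by positivity)
    _ = _ := by field_simp

theorem hasDerivAt_integral_cos_pow_mul_exp (n : ℕ) (t : ℝ) :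
    HasDerivAt (fun s => ∫ θ in (0 : ℝ)..Real.pi, Real.cos θ ^ n * Real.exp (s * Real.cos θ))
      (∫ θ in (0 : ℝ)..Real.pi, Real.cos θ ^ (n + 1) * Real.exp (t * Real.cos θ)) t := by
  have hcont : ∀ (n : ℕ) (s : ℝ), Continuous fun θ => Real.cos θ ^ n * Real.exp (s * Real.cos θ) :=
    fun n s => by fun_prop
  refine (intervalIntegral.hasDerivAt_integral_of_dominated_loc_of_deriv_le
    (F' := fun s θ => Real.cos θ ^ (n + 1) * Real.exp (s * Real.cos θ))
    (bound := fun _ => Real.exp (|t| + 1))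
    (Metric.ball_mem_nhds t one_pos)
    (Filter.Eventually.of_forall fun s => (hcont n s).aestronglyMeasurable)
    ((hcont n t).intervalIntegrable _ _) (hcont _ t).aestronglyMeasurable
    (Filter.Eventually.of_forall fun θ _ s hs => ?_) (by simp)
    (Filter.Eventually.of_forall fun θ _ s _ => ?_)).2
  · rw [norm_mul, norm_pow, Real.norm_eq_abs, Real.norm_of_nonneg (Real.exp_pos _).le]
    have h1 : |Real.cos θ| ^ (n + 1) ≤ 1 := pow_le_one₀ (abs_nonneg _) (Real.abs_cos_le_one θ)
    have hs' : |s| ≤ |t| + 1 := by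
      rw [Metric.mem_ball, Real.dist_eq] at hs
      have := abs_sub_abs_le_abs_sub s t
      linarith
    have h2 : Real.exp (s * Real.cos θ) ≤ Real.exp (|t| + 1) := by
      refine Real.exp_le_exp.2 (le_trans (le_abs_self _) ?_)
      rw [abs_mul]
      exact (mul_le_of_le_one_right (abs_nonneg _) (Real.abs_cos_le_one θ)).trans hs'
    calc _ ≤ 1 * Real.exp (|t| + 1) := mul_le_mul h1 h2 (Real.exp_pos _).le zero_le_one
      _ = _ := one_mul _
  · have := (((hasDerivAt_id s).mul_const (Real.cos θ)).exp).const_mul (Real.cos θ ^ n)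
    convert! this using 1
    simp only [id, pow_succ]
    ring

theorem hasDerivAt_besselI0 {t : ℝ} (ht : t ≠ 0) :
    HasDerivAt besselI0 (t⁻¹ * besselI0Euler t) t := by
  have := (hasDerivAt_integral_cos_pow_mul_exp 0 t).const_mul (1 / Real.pi)
  simp only [pow_zero, one_mul, zero_add, pow_one] at this
  rw [besselI0Euler, inv_mul_cancel_left₀ ht]
  exact this

theorem hasDerivAt_besselI0Euler (t : ℝ) : HasDerivAt besselI0Euler (t * besselI0 t) t := by
  have h := (hasDerivAt_id t).mul
    ((hasDerivAt_integral_cos_pow_mul_exp 1 t).const_mul (1 / Real.pi))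
  simp only [pow_one, id, one_mul, one_add_one_eq_two] at h
  refine Eq.mp (congrArg (fun q => HasDerivAt _ q t) ?_) h
  have hi : ∀ n : ℕ, IntervalIntegrable (fun θ => Real.cos θ ^ n * Real.exp (t * Real.cos θ))
      MeasureTheory.volume 0 Real.pi := fun n => Continuous.intervalIntegrable (by fun_prop) _ _
  -- Integration by parts: the integrand is the derivative of sin θ · e^{t cos θ}, which vanishes at
  -- both endpoints.
  have h0 : ∫ θ in (0 : ℝ)..Real.pi, (Real.cos θ ^ 1 * Real.exp (t * Real.cos θ) -
      t * (Real.cos θ ^ 0 * Real.exp (t * Real.cos θ) -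
        Real.cos θ ^ 2 * Real.exp (t * Real.cos θ))) = 0 := by
    rw [intervalIntegral.integral_eq_sub_of_hasDerivAt
      (f := fun θ => Real.sin θ * Real.exp (t * Real.cos θ))]
    · simp
    · intro θ _
      have := (Real.hasDerivAt_sin θ).mul (((Real.hasDerivAt_cos θ).const_mul t).exp)
      convert! this using 1
      linear_combination (t * Real.exp (t * Real.cos θ)) * Real.sin_sq_add_cos_sq θ
    · exact (hi 1).sub (((hi 0).sub (hi 2)).const_mul t)
  rw [intervalIntegral.integral_sub (hi 1) (((hi 0).sub (hi 2)).const_mul t),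
    intervalIntegral.integral_const_mul, intervalIntegral.integral_sub (hi 0) (hi 2)] at h0
  simp only [pow_zero, one_mul, pow_one] at h0
  rw [besselI0]
  linear_combination (1 / Real.pi) * h0

theorem abs_besselI0_le {t : ℝ} (ht : 0 ≤ t) : |besselI0 t| ≤ Real.exp t := by
  simpa [besselI0] using abs_integral_cos_pow_mul_exp_le 0 ht

theorem abs_besselI0Euler_le {t : ℝ} (ht : 0 ≤ t) : |besselI0Euler t| ≤ t * Real.exp t := by
  rw [besselI0Euler, abs_mul, abs_of_nonneg ht]
  have := abs_integral_cos_pow_mul_exp_le 1 ht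
  simp only [pow_one] at this
  exact mul_le_mul_of_nonneg_left this ht

/-! ### The function K₀ and its Euler derivative -/

theorem half_exp_le_cosh (u : ℝ) : Real.exp u / 2 ≤ Real.cosh u := by
  rw [Real.cosh_eq]
  have := Real.exp_pos (-u)
  linarith

/-- From x^(n+1)/(n+1)! ≤ e^x at x = t cosh u: the spare factor cosh u ≥ e^u/2 supplies the decay
e^{-u}. -/
theorem cosh_pow_mul_exp_le (n : ℕ) {t : ℝ} (ht : 0 < t) (u : ℝ) :
    Real.cosh u ^ n * Real.exp (-(t * Real.cosh u)) ≤
      2 * (n + 1).factorial / t ^ (n + 1) * Real.exp (-u) := by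
  have hc := Real.cosh_pos u
  have h := Real.pow_div_factorial_le_exp (t * Real.cosh u) (by positivity) (n + 1)
  have h2 := half_exp_le_cosh u
  rw [Real.exp_neg, Real.exp_neg]
  rw [div_le_iff₀ (by positivity), mul_pow] at h
  have hE := Real.exp_pos (t * Real.cosh u)
  have hu := Real.exp_pos u
  rw [← div_eq_mul_inv, div_le_iff₀ hE, div_mul_eq_mul_div, ← div_eq_mul_inv, div_div,
    div_mul_eq_mul_div, le_div_iff₀ (by positivity)]
  calc Real.cosh u ^ n * (Real.exp u * t ^ (n + 1))
      = Real.cosh u ^ n * (t ^ (n + 1) * Real.exp u) := by ring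
    _ ≤ Real.cosh u ^ n * (t ^ (n + 1) * (2 * Real.cosh u)) := by gcongr; linarith
    _ = 2 * (t ^ (n + 1) * Real.cosh u ^ (n + 1)) := by ring
    _ ≤ 2 * (Real.exp (t * Real.cosh u) * (n + 1).factorial) := by gcongr
    _ = 2 * (n + 1).factorial * Real.exp (t * Real.cosh u) := by ring

open MeasureTheory in
theorem integrableOn_cosh_pow_mul_exp (n : ℕ) {t : ℝ} (ht : 0 < t) :
    IntegrableOn (fun u => Real.cosh u ^ n * Real.exp (-(t * Real.cosh u))) (Set.Ioi 0) := by
  refine Integrable.mono' ((integrableOn_exp_neg_Ioi 0).const_mul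
    (2 * (n + 1).factorial / t ^ (n + 1)))
    (Continuous.aestronglyMeasurable (by fun_prop)) (Filter.Eventually.of_forall fun u => ?_)
  have hc := Real.cosh_pos u
  rw [Real.norm_of_nonneg (by positivity)]
  exact cosh_pow_mul_exp_le n ht u

open MeasureTheory in
theorem hasDerivAt_integral_cosh_pow_mul_exp (n : ℕ) {t : ℝ} (ht : 0 < t) :
    HasDerivAt (fun s => ∫ u in Set.Ioi (0 : ℝ), Real.cosh u ^ n * Real.exp (-(s * Real.cosh u)))
      (-∫ u in Set.Ioi (0 : ℝ), Real.cosh u ^ (n + 1) * Real.exp (-(t * Real.cosh u))) t := by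
  have hcont : ∀ (n : ℕ) (s : ℝ),
      Continuous fun u => Real.cosh u ^ n * Real.exp (-(s * Real.cosh u)) :=
    fun n s => by fun_prop
  rw [← integral_neg]
  refine (hasDerivAt_integral_of_dominated_loc_of_deriv_le
    (F' := fun s u => -(Real.cosh u ^ (n + 1) * Real.exp (-(s * Real.cosh u))))
    (bound := fun u => Real.cosh u ^ (n + 1) * Real.exp (-(t / 2 * Real.cosh u)))
    (Ioi_mem_nhds (show t / 2 < t by linarith))
    (Filter.Eventually.of_forall fun s => (hcont n s).aestronglyMeasurable)
    (integrableOn_cosh_pow_mul_exp n ht) (hcont _ t).neg.aestronglyMeasurable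
    (Filter.Eventually.of_forall fun u s hs => ?_)
    (integrableOn_cosh_pow_mul_exp (n + 1) (half_pos ht))
    (Filter.Eventually.of_forall fun u s _ => ?_)).2
  · have hc := Real.cosh_pos u
    rw [norm_neg, Real.norm_of_nonneg (by positivity)]
    have : t / 2 < s := hs
    gcongr
  · have := ((((hasDerivAt_id s).mul_const (Real.cosh u)).neg).exp).const_mul (Real.cosh u ^ n)
    convert! this using 1
    simp only [id, pow_succ, Pi.neg_apply]
    ring

/-- `t` times the derivative of `K₀`. -/
noncomputable def besselK0Euler (t : ℝ) : ℝ :=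
  -(t * ∫ u in Set.Ioi (0 : ℝ), Real.cosh u * Real.exp (-(t * Real.cosh u)))

theorem hasDerivAt_besselK0 {t : ℝ} (ht : 0 < t) :
    HasDerivAt besselK0 (t⁻¹ * besselK0Euler t) t := by
  have := hasDerivAt_integral_cosh_pow_mul_exp 0 ht
  simp only [pow_zero, one_mul, zero_add, pow_one] at this
  rw [besselK0Euler, ← mul_neg, inv_mul_cancel_left₀ ht.ne']
  exact this

open Filter Topology in
theorem tendsto_cosh_pow_mul_exp (n : ℕ) {t : ℝ} (ht : 0 < t) :
    Tendsto (fun u => Real.cosh u ^ n * Real.exp (-(t * Real.cosh u))) atTop (𝓝 0) := by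
  refine squeeze_zero (fun u => ?_) (cosh_pow_mul_exp_le n ht) ?_
  · have := Real.cosh_pos u
    positivity
  · simpa using (Real.tendsto_exp_neg_atTop_nhds_zero).const_mul
      (2 * ((n + 1).factorial : ℝ) / t ^ (n + 1))

open MeasureTheory Filter Topology in
theorem hasDerivAt_besselK0Euler {t : ℝ} (ht : 0 < t) :
    HasDerivAt besselK0Euler (t * besselK0 t) t := by
  have h := ((hasDerivAt_id t).mul (hasDerivAt_integral_cosh_pow_mul_exp 1 ht)).neg
  simp only [pow_one, id, one_mul, one_add_one_eq_two] at h
  refine Eq.mp (congrArg (fun q => HasDerivAt _ q t) ?_) h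
  have hi := fun n : ℕ => integrableOn_cosh_pow_mul_exp n ht
  have hd : IntegrableOn (fun u => Real.cosh u ^ 2 * Real.exp (-(t * Real.cosh u)) -
      Real.cosh u ^ 0 * Real.exp (-(t * Real.cosh u))) (Set.Ioi 0) := (hi 2).sub (hi 0)
  -- As for I₀, the integrand is an exact derivative, now of sinh u · e^{-t cosh u}.
  have h0 : ∫ u in Set.Ioi (0 : ℝ), (Real.cosh u ^ 1 * Real.exp (-(t * Real.cosh u)) -
      t * (Real.cosh u ^ 2 * Real.exp (-(t * Real.cosh u)) -
        Real.cosh u ^ 0 * Real.exp (-(t * Real.cosh u)))) = 0 := by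
    rw [integral_Ioi_of_hasDerivAt_of_tendsto' (m := 0)
      (f := fun u => Real.sinh u * Real.exp (-(t * Real.cosh u)))]
    · simp
    · intro u _
      have := (Real.hasDerivAt_sinh u).mul ((((Real.hasDerivAt_cosh u).const_mul t).neg).exp)
      convert! this using 1
      linear_combination (-t * Real.exp (-(t * Real.cosh u))) * Real.cosh_sq u
    · exact (hi 1).sub (hd.const_mul t)
    · have h1 := tendsto_cosh_pow_mul_exp 1 ht
      refine squeeze_zero_norm' ?_ h1
      filter_upwards with u
      rw [norm_mul, Real.norm_of_nonneg (Real.exp_pos _).le, pow_one]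
      refine mul_le_mul_of_nonneg_right ?_ (Real.exp_pos _).le
      rw [Real.norm_eq_abs, ← Real.sqrt_sq_eq_abs]
      apply Real.sqrt_le_iff.2
      exact ⟨(Real.cosh_pos u).le, by rw [Real.cosh_sq]; linarith⟩
  rw [integral_sub (hi 1) (hd.const_mul t),
    integral_const_mul, integral_sub (hi 2) (hi 0)] at h0
  simp only [pow_zero, one_mul, pow_one] at h0
  rw [besselK0]
  linear_combination -h0

-- Split cosh u = sinh u + e^{-u}. The sinh part integrates exactly and gives e^{-t}; the rest is at
-- most t ∫ e^{-u} du = t. This yields the limit -1 of θK₀ at 0, the source of the only nonzero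
-- boundary value.
open MeasureTheory in
theorem abs_besselK0Euler_add_exp_le {t : ℝ} (ht : 0 < t) :
    |besselK0Euler t + Real.exp (-t)| ≤ t := by
  have hc := integrableOn_cosh_pow_mul_exp 1 ht
  simp only [pow_one] at hc
  have hexp : ∀ u : ℝ, Real.cosh u * Real.exp (-(t * Real.cosh u)) -
      Real.sinh u * Real.exp (-(t * Real.cosh u)) =
      Real.exp (-u) * Real.exp (-(t * Real.cosh u)) := fun u => by
    rw [← sub_mul, Real.cosh_sub_sinh]
  have hle : ∀ u : ℝ, Real.exp (-u) * Real.exp (-(t * Real.cosh u)) ≤ Real.exp (-u) := fun u =>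
    mul_le_of_le_one_right (Real.exp_pos _).le
      (Real.exp_le_one_iff.2 (by have := Real.cosh_pos u; nlinarith))
  have he : IntegrableOn (fun u => Real.exp (-u) * Real.exp (-(t * Real.cosh u))) (Set.Ioi 0) := by
    refine Integrable.mono' (integrableOn_exp_neg_Ioi 0)
      (Continuous.aestronglyMeasurable (by fun_prop)) (Filter.Eventually.of_forall fun u => ?_)
    rw [Real.norm_of_nonneg (by positivity)]
    exact hle u
  have hs : IntegrableOn (fun u => Real.sinh u * Real.exp (-(t * Real.cosh u))) (Set.Ioi 0) :=
    (hc.sub he).congr (Filter.Eventually.of_forall fun u => by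
      simp only [Pi.sub_apply]
      linarith [hexp u])
  have e1 : ∫ u in Set.Ioi (0 : ℝ), t * (Real.sinh u * Real.exp (-(t * Real.cosh u))) =
      Real.exp (-t) := by
    rw [integral_Ioi_of_hasDerivAt_of_tendsto' (m := 0)
      (f := fun u => -Real.exp (-(t * Real.cosh u)))]
    · simp
    · intro u _
      have := ((((Real.hasDerivAt_cosh u).const_mul t).neg).exp).neg
      convert! this using 1
      simp only [Pi.neg_apply]
      ring
    · exact hs.const_mul t
    · have := (tendsto_cosh_pow_mul_exp 0 ht).neg
      simpa using this
  have e2 := integral_sub hc hs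
  simp only [hexp] at e2
  rw [integral_const_mul] at e1
  have e3 : besselK0Euler t + Real.exp (-t) =
      -(t * ∫ u in Set.Ioi (0 : ℝ), Real.exp (-u) * Real.exp (-(t * Real.cosh u))) := by
    rw [e2, besselK0Euler]
    linarith
  have n0 : 0 ≤ ∫ u in Set.Ioi (0 : ℝ), Real.exp (-u) * Real.exp (-(t * Real.cosh u)) :=
    integral_nonneg fun u => by positivity
  have n1 : ∫ u in Set.Ioi (0 : ℝ), Real.exp (-u) * Real.exp (-(t * Real.cosh u)) ≤ 1 := by
    refine (integral_mono he (integrableOn_exp_neg_Ioi 0) hle).trans ?_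
    rw [integral_exp_neg_Ioi_zero]
  rw [e3, abs_neg, abs_of_nonneg (by positivity)]
  exact mul_le_of_le_one_right ht.le n1

open Filter Topology in
theorem tendsto_besselK0Euler : Tendsto besselK0Euler (𝓝[>] 0) (𝓝 (-1)) := by
  have h1 : Tendsto (fun t => besselK0Euler t + Real.exp (-t)) (𝓝[>] 0) (𝓝 0) := by
    refine squeeze_zero_norm' (a := fun t => t) ?_ (tendsto_nhdsWithin_of_tendsto_nhds tendsto_id)
    filter_upwards [self_mem_nhdsWithin] with t ht using abs_besselK0Euler_add_exp_le ht
  have h2 : Tendsto (fun t : ℝ => Real.exp (-t)) (𝓝[>] 0) (𝓝 1) := by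
    have : Continuous fun t : ℝ => Real.exp (-t) := by fun_prop
    simpa using tendsto_nhdsWithin_of_tendsto_nhds (this.tendsto 0)
  simpa using h1.sub h2

open Filter Topology in
theorem tendsto_besselI0Euler : Tendsto besselI0Euler (𝓝[>] 0) (𝓝 0) := by
  have : Continuous fun t : ℝ => t * Real.exp t := by fun_prop
  refine squeeze_zero_norm' (a := fun t => t * Real.exp t) ?_
    (by simpa using tendsto_nhdsWithin_of_tendsto_nhds (this.tendsto 0))
  filter_upwards [self_mem_nhdsWithin] with t ht using abs_besselI0Euler_le (le_of_lt ht)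

/-! ### Growth of the Bessel functions at 0 and at infinity -/

open Filter in
theorem eventually_one_le_exp : ∀ᶠ t : ℝ in atTop, 1 ≤ Real.exp t :=
  (eventually_ge_atTop 0).mono fun _ ht => Real.one_le_exp ht

open Filter Topology in
theorem eventually_one_le_inv : ∀ᶠ t : ℝ in 𝓝[>] 0, 1 ≤ t⁻¹ := by
  filter_upwards [Ioo_mem_nhdsGT (show (0 : ℝ) < 1 by norm_num)] with t ht
  exact (one_le_inv₀ ht.1).2 ht.2.le

open Filter Topology in
theorem growthLE_zero_of_tendsto {f : ℝ → ℝ} {a : ℝ} (hf : Tendsto f (𝓝[>] 0) (𝓝 a)) :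
    GrowthLE (𝓝[>] 0) (fun t => t⁻¹) 0 f :=
  GrowthLE.of_isBigO eventually_one_le_inv (by simpa using hf.isBigO_one ℝ)

open Filter Asymptotics Topology in
theorem growthLE_besselI0_zero : GrowthLE (𝓝[>] 0) (fun t => t⁻¹) 0 besselI0 := by
  refine GrowthLE.of_isBigO eventually_one_le_inv (IsBigO.of_bound (Real.exp 1) ?_)
  filter_upwards [Ioo_mem_nhdsGT (show (0 : ℝ) < 1 by norm_num)] with t ht
  simpa using (abs_besselI0_le ht.1.le).trans (Real.exp_le_exp.2 ht.2.le)

open Filter Topology in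
theorem growthLE_besselI0Euler_zero : GrowthLE (𝓝[>] 0) (fun t => t⁻¹) 0 besselI0Euler :=
  growthLE_zero_of_tendsto tendsto_besselI0Euler

open Filter Topology in
theorem growthLE_besselK0Euler_zero : GrowthLE (𝓝[>] 0) (fun t => t⁻¹) 0 besselK0Euler :=
  growthLE_zero_of_tendsto tendsto_besselK0Euler

theorem exp_neg_le_rpow_neg {δ x : ℝ} (hδ : 0 ≤ δ) (hδ1 : δ ≤ 1) (hx : 0 < x) :
    Real.exp (-x) ≤ x ^ (-δ) := by
  rw [Real.exp_neg, Real.rpow_neg hx.le]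
  refine inv_anti₀ (by positivity) ?_
  rcases le_total x 1 with h | h
  · exact (Real.rpow_le_one hx.le h hδ).trans (Real.one_le_exp hx.le)
  · calc x ^ δ ≤ x ^ (1 : ℝ) := Real.rpow_le_rpow_of_exponent_le h hδ1
      _ = x := Real.rpow_one x
      _ ≤ Real.exp x := by linarith [Real.add_one_le_exp x]

-- A substitute for the logarithmic asymptotics: e^{-x} ≤ x^{-δ} and cosh u ≥ e^u/2 leave the
-- integrable factor e^{-δu}.
open MeasureTheory in
theorem besselK0_le_rpow {δ t : ℝ} (hδ : 0 < δ) (hδ1 : δ ≤ 1) (ht : 0 < t) :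
    besselK0 t ≤ (2 ^ δ * ∫ u in Set.Ioi (0 : ℝ), Real.exp (-δ * u)) * t⁻¹ ^ δ := by
  have hi := integrableOn_cosh_pow_mul_exp 0 ht
  simp only [pow_zero, one_mul] at hi
  have hj : IntegrableOn (fun u : ℝ => 2 ^ δ * t⁻¹ ^ δ * Real.exp (-δ * u)) (Set.Ioi 0) :=
    (integrableOn_exp_mul_Ioi (show -δ < 0 by linarith) 0).const_mul _
  have := integral_mono hi hj fun u => ?_
  · rw [integral_const_mul] at this
    rw [besselK0]
    linarith
  · have hc := half_exp_le_cosh u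
    have he := Real.exp_pos u
    calc Real.exp (-(t * Real.cosh u)) ≤ (t * Real.cosh u) ^ (-δ) :=
          exp_neg_le_rpow_neg hδ.le hδ1 (mul_pos ht (Real.cosh_pos u))
      _ ≤ (t * (Real.exp u / 2)) ^ (-δ) :=
          Real.rpow_le_rpow_of_nonpos (by positivity) (by gcongr) (by linarith)
      _ = 2 ^ δ * t⁻¹ ^ δ * Real.exp (-δ * u) := by
          rw [Real.mul_rpow ht.le (by positivity), Real.div_rpow he.le zero_le_two,
            ← Real.exp_mul, Real.inv_rpow ht.le, Real.rpow_neg ht.le, Real.rpow_neg zero_le_two,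
            div_inv_eq_mul, mul_comm u]
          ring

theorem besselK0_nonneg (t : ℝ) : 0 ≤ besselK0 t :=
  MeasureTheory.integral_nonneg fun _ => (Real.exp_pos _).le

open Filter Asymptotics Topology in
theorem growthLE_besselK0_zero : GrowthLE (𝓝[>] 0) (fun t => t⁻¹) 0 besselK0 := by
  intro ε hε
  set δ := min ε 1
  have hδ : 0 < δ := lt_min hε one_pos
  have h : besselK0 =O[𝓝[>] 0] fun t : ℝ => t⁻¹ ^ δ := by
    refine IsBigO.of_bound (2 ^ δ * ∫ u in Set.Ioi (0 : ℝ), Real.exp (-δ * u)) ?_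
    filter_upwards [self_mem_nhdsWithin] with t ht
    have ht' : (0 : ℝ) < t := ht
    rw [Real.norm_of_nonneg (besselK0_nonneg t), Real.norm_of_nonneg (by positivity)]
    exact besselK0_le_rpow hδ (min_le_right _ _) ht'
  refine h.trans (IsBigO.of_bound 1 ?_)
  filter_upwards [eventually_one_le_inv] with t ht
  rw [one_mul, Real.norm_of_nonneg (Real.rpow_nonneg (by linarith) _),
    Real.norm_of_nonneg (Real.rpow_nonneg (by linarith) _)]
  exact Real.rpow_le_rpow_of_exponent_le ht (by rw [zero_add]; exact min_le_left _ _)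

open Filter Asymptotics Topology in
theorem growthLE_id_top : GrowthLE atTop Real.exp 0 fun t => t := by
  intro ε hε
  have := (isLittleO_pow_exp_pos_mul_atTop 1 hε).isBigO
  refine this.congr (fun t => pow_one t) fun t => ?_
  rw [← Real.exp_mul, zero_add, mul_comm]

open MeasureTheory in
theorem integral_cosh_pow_mul_exp_le (n : ℕ) {t : ℝ} (ht : 1 ≤ t) :
    ∫ u in Set.Ioi (0 : ℝ), Real.cosh u ^ n * Real.exp (-(t * Real.cosh u)) ≤
      (Real.exp 1 * ∫ u in Set.Ioi (0 : ℝ), Real.cosh u ^ n * Real.exp (-(1 * Real.cosh u))) *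
        Real.exp (-t) := by
  have := integral_mono (integrableOn_cosh_pow_mul_exp n (zero_lt_one.trans_le ht))
    ((integrableOn_cosh_pow_mul_exp n one_pos).const_mul (Real.exp 1 * Real.exp (-t))) fun u => ?_
  · rw [integral_const_mul] at this
    linarith
  -- Since (t - 1)(cosh u - 1) ≥ 0, one has t cosh u ≥ t - 1 + cosh u.
  · have hc := Real.one_le_cosh u
    calc Real.cosh u ^ n * Real.exp (-(t * Real.cosh u))
        ≤ Real.cosh u ^ n * Real.exp (1 + -t + -(1 * Real.cosh u)) := by
          gcongr
          nlinarith
      _ = _ := by rw [Real.exp_add, Real.exp_add]; ring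

open Filter Asymptotics Topology in
theorem growthLE_integral_cosh_pow_mul_exp (n : ℕ) : GrowthLE atTop Real.exp (-1) fun t =>
    ∫ u in Set.Ioi (0 : ℝ), Real.cosh u ^ n * Real.exp (-(t * Real.cosh u)) := by
  refine GrowthLE.of_isBigO eventually_one_le_exp (IsBigO.of_bound (Real.exp 1 *
    ∫ u in Set.Ioi (0 : ℝ), Real.cosh u ^ n * Real.exp (-(1 * Real.cosh u))) ?_)
  filter_upwards [eventually_ge_atTop 1] with t ht
  rw [Real.norm_of_nonneg (MeasureTheory.integral_nonneg fun u => by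
    have := Real.cosh_pos u
    positivity), ← Real.exp_mul, Real.norm_of_nonneg (Real.exp_pos _).le, mul_neg_one]
  exact integral_cosh_pow_mul_exp_le n ht

open Filter in
theorem growthLE_besselK0_top : GrowthLE atTop Real.exp (-1) besselK0 := by
  have := growthLE_integral_cosh_pow_mul_exp 0
  simp only [pow_zero, one_mul] at this
  exact this

open Filter in
theorem growthLE_besselK0Euler_top : GrowthLE atTop Real.exp (-1) besselK0Euler := by
  have hh : ∀ᶠ t : ℝ in atTop, 0 < Real.exp t := Eventually.of_forall Real.exp_pos
  have := ((GrowthLE.const eventually_one_le_exp (-1)).mul hh growthLE_id_top).mul hh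
    (growthLE_integral_cosh_pow_mul_exp 1)
  simp only [pow_one, add_zero, zero_add, neg_mul, one_mul] at this
  exact this

open Filter Asymptotics in
theorem growthLE_besselI0_top : GrowthLE atTop Real.exp 1 besselI0 := by
  refine GrowthLE.of_isBigO eventually_one_le_exp (IsBigO.of_bound 1 ?_)
  filter_upwards [eventually_ge_atTop 0] with t ht
  simpa using abs_besselI0_le ht

open Filter Asymptotics in
theorem growthLE_besselI0Euler_top : GrowthLE atTop Real.exp 1 besselI0Euler := by
  have hh : ∀ᶠ t : ℝ in atTop, 0 < Real.exp t := Eventually.of_forall Real.exp_pos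
  have h1 : GrowthLE atTop Real.exp 1 Real.exp :=
    GrowthLE.of_isBigO eventually_one_le_exp (by simpa using isBigO_refl _ _)
  have h2 := growthLE_id_top.mul hh h1
  rw [zero_add] at h2
  intro ε hε
  refine IsBigO.trans (IsBigO.of_bound 1 ?_) (h2 ε hε)
  filter_upwards [eventually_ge_atTop 0] with t ht
  rw [one_mul, Real.norm_of_nonneg (mul_nonneg ht (Real.exp_pos t).le)]
  exact abs_besselI0Euler_le ht

/-! ### Improper integration, boundary limits and convergence of the moments -/

open Filter Topology in
/-- An improper fundamental theorem of calculus on `(0, ∞)`. -/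
theorem integral_Ioi_zero_of_tendsto {g g' : ℝ → ℝ} {l r : ℝ}
    (hg : ∀ t, 0 < t → HasDerivAt g (g' t) t)
    (hi : MeasureTheory.IntegrableOn g' (Set.Ioi 0)) (hl : Tendsto g (𝓝[>] 0) (𝓝 l))
    (hr : Tendsto g atTop (𝓝 r)) : ∫ t in Set.Ioi (0 : ℝ), g' t = r - l := by
  -- The value of g at 0 is arbitrary, so it is replaced by the limit l to obtain continuity at the
  -- endpoint.
  have h := MeasureTheory.integral_Ioi_of_hasDerivAt_of_tendsto (f := Function.update g 0 l)
    (f' := g') (a := 0) (m := r) ?_ (fun t ht => ?_) hi ?_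
  · simpa using h
  · rw [continuousWithinAt_update_same, Set.Ici_sdiff_left]
    exact hl
  · refine (hg t ht).congr_of_eventuallyEq ?_
    filter_upwards [eventually_ne_nhds (ne_of_gt ht)] with s hs
    exact Function.update_of_ne hs _ _
  · refine hr.congr' ?_
    filter_upwards [eventually_ne_atTop 0] with s hs
    exact (Function.update_of_ne hs _ _).symm

open Filter Asymptotics Topology in
theorem tendsto_zero_of_growthLE_exp {f : ℝ → ℝ} {c : ℝ} (hc : c < 0)
    (hf : GrowthLE atTop Real.exp c f) : Tendsto f atTop (𝓝 0) := by
  refine (hf (-c / 2) (by linarith)).trans_tendsto ?_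
  have h : Tendsto (fun t : ℝ => c / 2 * t) atTop atBot :=
    tendsto_id.const_mul_atTop_of_neg (by linarith)
  refine (Real.tendsto_exp_atBot.comp h).congr fun t => ?_
  rw [Function.comp_apply, ← Real.exp_mul]
  congr 1
  ring

open Filter Asymptotics Topology in
theorem tendsto_sq_mul_of_growthLE_inv {f : ℝ → ℝ}
    (hf : GrowthLE (𝓝[>] 0) (fun t => t⁻¹) 0 f) :
    Tendsto (fun t => t ^ 2 * f t) (𝓝[>] 0) (𝓝 0) := by
  have h := (isBigO_refl (fun t : ℝ => t ^ 2) (𝓝[>] 0)).mul (hf 1 one_pos)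
  refine h.trans_tendsto ?_
  have h0 : Tendsto (fun t : ℝ => t) (𝓝[>] 0) (𝓝 0) :=
    tendsto_nhdsWithin_of_tendsto_nhds tendsto_id
  refine h0.congr' ?_
  filter_upwards [self_mem_nhdsWithin] with t ht
  have : t ≠ 0 := ne_of_gt ht
  rw [zero_add, Real.rpow_one]
  field_simp

open Polynomial in
theorem coeff_C_add_C_mul_X_pow (x y : ℝ) {m a : ℕ} (ha : a ≤ m) :
    ((C x + C y * X : ℝ[X]) ^ m).coeff a = m.choose a * (y ^ a * x ^ (m - a)) := by
  have h : (C x + C y * X : ℝ[X]) ^ m =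
      ∑ i ∈ Finset.range (m + 1), C (m.choose i * (y ^ i * x ^ (m - i))) * X ^ i := by
    rw [add_comm, add_pow]
    refine Finset.sum_congr rfl fun i _ => ?_
    rw [mul_pow, C_mul, C_mul, C_pow, C_pow, ← C_eq_natCast]
    ring
  rw [h, finsetSum_coeff]
  simp only [coeff_C_mul, coeff_X_pow]
  rw [Finset.sum_eq_single a]
  · simp
  · intro i _ hi
    simp [Ne.symm hi]
  · intro h
    exact absurd (Finset.mem_range.2 (by omega)) h

theorem continuousOn_besselI0 : ContinuousOn besselI0 (Set.Ioi 0) := fun _ ht =>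
  (hasDerivAt_besselI0 (ne_of_gt ht)).continuousAt.continuousWithinAt

theorem continuousOn_besselK0 : ContinuousOn besselK0 (Set.Ioi 0) := fun _ ht =>
  (hasDerivAt_besselK0 ht).continuousAt.continuousWithinAt

open Filter Topology in
theorem growthLE_id_zero : GrowthLE (𝓝[>] 0) (fun t => t⁻¹) 0 fun t => t :=
  growthLE_zero_of_tendsto (tendsto_nhdsWithin_of_tendsto_nhds tendsto_id)

open Filter Topology in
theorem growthLE_sq_zero : GrowthLE (𝓝[>] 0) (fun t => t⁻¹) 0 fun t => t ^ 2 := by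
  simpa using growthLE_id_zero.pow eventually_one_le_inv 2

open Filter in
theorem growthLE_sq_top : GrowthLE atTop Real.exp 0 fun t => t ^ 2 := by
  simpa using growthLE_id_top.pow eventually_one_le_exp 2

open Filter Topology in
theorem integrableOn_besselI0_pow_mul_besselK0_pow {R : Type*} [CommRing R] [Algebra R ℝ]
    {a b : ℕ} (hab : a < b) (p : Polynomial R) :
    MeasureTheory.IntegrableOn (fun t : ℝ => besselI0 t ^ a * besselK0 t ^ b * t *
      Polynomial.aeval (t ^ 2) p) (Set.Ioi 0) := by
  have h0 : ∀ᶠ t : ℝ in 𝓝[>] 0, 0 < t⁻¹ := eventually_one_le_inv.mono fun t ht => by linarith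
  have h1 : ∀ᶠ t : ℝ in atTop, 0 < Real.exp t := Eventually.of_forall Real.exp_pos
  have g0 := (((growthLE_besselI0_zero.pow eventually_one_le_inv a).mul h0
    (growthLE_besselK0_zero.pow eventually_one_le_inv b)).mul h0 growthLE_id_zero).mul h0
    (growthLE_sq_zero.aeval eventually_one_le_inv p)
  have g1 := (((growthLE_besselI0_top.pow eventually_one_le_exp a).mul h1
    (growthLE_besselK0_top.pow eventually_one_le_exp b)).mul h1 growthLE_id_top).mul h1
    (growthLE_sq_top.aeval eventually_one_le_exp p)
  refine integrableOn_Ioi_of_growthLE ?_ (by simpa using g0) ?_ g1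
  · exact (((continuousOn_besselI0.pow a).mul (continuousOn_besselK0.pow b)).mul
      continuousOn_id).mul (((Polynomial.continuous_aeval p).comp
        (continuous_pow 2)).continuousOn)
  · have : (a : ℝ) < b := by exact_mod_cast hab
    linarith

/-! ### The pencil K₀ + X I₀ and the sum rules -/

open Polynomial in
/-- The solution `K₀ + X I₀` of the Bessel equation with a formal parameter. -/
noncomputable def besselPencil (t : ℝ) : ℝ[X] := C (besselK0 t) + C (besselI0 t) * X

open Polynomial in
/-- `t` times the derivative of `besselPencil`. -/
noncomputable def besselPencilEuler (t : ℝ) : ℝ[X] :=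
  C (besselK0Euler t) + C (besselI0Euler t) * X

open Polynomial in
theorem hasPolyDerivAt_besselPencil {t : ℝ} (ht : 0 < t) :
    HasPolyDerivAt besselPencil (C t⁻¹ * besselPencilEuler t) t := by
  have := HasPolyDerivAt.linear (hasDerivAt_besselK0 ht) (hasDerivAt_besselI0 ht.ne')
  refine Eq.mp (congrArg (fun q => HasPolyDerivAt _ q t) ?_) this
  rw [besselPencilEuler, C_mul, C_mul]
  ring

open Polynomial in
theorem hasPolyDerivAt_besselPencilEuler {t : ℝ} (ht : 0 < t) :
    HasPolyDerivAt besselPencilEuler (C t * besselPencil t) t := by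
  have := HasPolyDerivAt.linear (hasDerivAt_besselK0Euler ht) (hasDerivAt_besselI0Euler t)
  refine Eq.mp (congrArg (fun q => HasPolyDerivAt _ q t) ?_) this
  rw [besselPencil, C_mul, C_mul]
  ring

open Filter Polynomial Topology in
theorem tendsto_besselPencilEuler : ∀ a,
    Tendsto (fun t => (besselPencilEuler t).coeff a) (𝓝[>] 0) (𝓝 ((C (-1) : ℝ[X]).coeff a))
  | 0 => by simpa [besselPencilEuler] using tendsto_besselK0Euler
  | 1 => by simpa [besselPencilEuler, coeff_C, coeff_one] using tendsto_besselI0Euler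
  | a + 2 => by simp [besselPencilEuler, coeff_one]

open Filter Topology in
theorem polyGrowthLE_bessel_zero (i j : ℕ) : PolyGrowthLE (𝓝[>] 0) (fun t => t⁻¹) 0 0
    fun t => besselPencil t ^ i * besselPencilEuler t ^ j := by
  have h0 : ∀ᶠ t : ℝ in 𝓝[>] 0, 0 < t⁻¹ := eventually_one_le_inv.mono fun t ht => by linarith
  have h1 : PolyGrowthLE (𝓝[>] 0) (fun t => t⁻¹) 0 0 besselPencil :=
    PolyGrowthLE.linear growthLE_besselK0_zero (by simpa using growthLE_besselI0_zero)
  have h2 : PolyGrowthLE (𝓝[>] 0) (fun t => t⁻¹) 0 0 besselPencilEuler :=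
    PolyGrowthLE.linear growthLE_besselK0Euler_zero (by simpa using growthLE_besselI0Euler_zero)
  simpa using (h1.pow eventually_one_le_inv i).mul h0 (h2.pow eventually_one_le_inv j)

-- K₀ decays like e^{-t} and I₀ grows like e^t, so each power of X costs e^{2t}: this is the slope
-- 2.
open Filter in
theorem polyGrowthLE_bessel_top (i j : ℕ) : PolyGrowthLE atTop Real.exp 2 (-((i : ℝ) + j))
    fun t => besselPencil t ^ i * besselPencilEuler t ^ j := by
  have hh : (2 : ℝ) + -1 = 1 := by norm_num
  have h1 : PolyGrowthLE atTop Real.exp 2 (-1) besselPencil :=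
    PolyGrowthLE.linear growthLE_besselK0_top (by rw [hh]; exact growthLE_besselI0_top)
  have h2 : PolyGrowthLE atTop Real.exp 2 (-1) besselPencilEuler :=
    PolyGrowthLE.linear growthLE_besselK0Euler_top (by rw [hh]; exact growthLE_besselI0Euler_top)
  have := (h1.pow eventually_one_le_exp i).mul (Eventually.of_forall Real.exp_pos)
    (h2.pow eventually_one_le_exp j)
  rwa [show (i : ℝ) * -1 + j * -1 = -((i : ℝ) + j) by ring] at this

open Filter Polynomial Topology in
theorem tendsto_sumRulePrimitive_zero (m k a : ℕ) :
    Tendsto (fun t => (sumRulePrimitive m k besselPencil besselPencilEuler m t).coeff a)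
      (𝓝[>] 0) (𝓝 (if k = 0 ∧ a = 0 then (-1) ^ m else 0)) := by
  -- The limit is laid out term by term: zeros for j ≥ 1, and for j = 0 the limit of t^{2k} V^m,
  -- where 0^{2k} selects k = 0 and the constant polynomial (-1)^m selects a = 0.
  have e : (if k = 0 ∧ a = 0 then (-1) ^ m else 0 : ℝ) =
      (∑ _j ∈ Finset.range m, 0) + (0 ^ 2) ^ k / 1 * ((C (-1) : ℝ[X]) ^ m).coeff a := by
    rw [← C_pow, coeff_C]
    rcases k with _ | k <;> rcases a with _ | a <;> simp
  rw [e]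
  simp only [sumRulePrimitive, Finset.sum_range_succ' _ m, coeff_add, finsetSum_coeff, coeff_C_mul]
  refine (tendsto_finsetSum _ fun j _ => ?_).add ?_
  · obtain ⟨q, hq⟩ := X_dvd_adjointPoly m k j
    have h0 : ∀ᶠ t : ℝ in 𝓝[>] 0, 0 < t⁻¹ := eventually_one_le_inv.mono fun t ht => by linarith
    have hp : GrowthLE (𝓝[>] 0) (fun t => t⁻¹) 0 fun t =>
        (besselPencil t ^ (j + 1) * besselPencilEuler t ^ (m - (j + 1))).coeff a := by
      simpa using polyGrowthLE_bessel_zero (j + 1) (m - (j + 1)) a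
    have hg := ((growthLE_sq_zero.aeval eventually_one_le_inv q).mul h0
      (GrowthLE.const eventually_one_le_inv ((Nat.factorial (j + 1) : ℝ)⁻¹))).mul h0 hp
    simp only [add_zero] at hg
    refine (tendsto_sq_mul_of_growthLE_inv hg).congr fun t => ?_
    rw [hq, map_mul, aeval_X]
    ring
  · have h0 : Tendsto (fun t : ℝ => (t ^ 2) ^ k / 1) (𝓝[>] 0) (𝓝 ((0 ^ 2) ^ k / 1)) :=
      tendsto_nhdsWithin_of_tendsto_nhds
        ((by fun_prop : Continuous fun t : ℝ => (t ^ 2) ^ k / 1).tendsto 0)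
    refine (h0.mul (tendsto_coeff_pow tendsto_besselPencilEuler m a)).congr fun t => ?_
    rw [adjointPoly]
    simp

open Filter Polynomial Topology in
theorem tendsto_sumRulePrimitive_top {m a : ℕ} (k : ℕ) (ha : 2 * a < m) :
    Tendsto (fun t => (sumRulePrimitive m k besselPencil besselPencilEuler m t).coeff a)
      atTop (𝓝 0) := by
  have ha' : (2 : ℝ) * a < m := by exact_mod_cast ha
  refine tendsto_zero_of_growthLE_exp (c := 2 * a - m) (by linarith) ?_
  simp only [sumRulePrimitive, finsetSum_coeff, coeff_C_mul]
  refine GrowthLE.sum _ fun j hj => ?_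
  have hjm : j ≤ m := Nat.lt_succ_iff.1 (Finset.mem_range.1 hj)
  have hh : ∀ᶠ t : ℝ in atTop, 0 < Real.exp t := Eventually.of_forall Real.exp_pos
  have h := ((growthLE_sq_top.aeval eventually_one_le_exp (adjointPoly m k j)).mul hh
    (GrowthLE.const eventually_one_le_exp ((Nat.factorial j : ℝ)⁻¹))).mul hh
    (polyGrowthLE_bessel_top j (m - j) a)
  rw [Nat.cast_sub hjm, show (0 : ℝ) + 0 + (2 * a + -((j : ℝ) + (m - j))) = 2 * a - m by ring] at h
  exact h

open Filter Polynomial Topology in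
/-- The sum rules for the products `I₀ ^ a K₀ ^ (m - a)`. -/
theorem integral_sumRulePoly {m a : ℕ} (k : ℕ) (ha : 2 * a < m) :
    ∫ t in Set.Ioi (0 : ℝ), besselI0 t ^ a * besselK0 t ^ (m - a) * t *
      aeval (t ^ 2) (sumRulePoly m k) =
      if k = 0 ∧ a = 0 then (-1) ^ m * (m.factorial : ℝ) else 0 := by
  set φ : ℝ → ℝ := fun t => besselI0 t ^ a * besselK0 t ^ (m - a) * t *
    aeval (t ^ 2) (sumRulePoly m k) with hφ
  have hi : MeasureTheory.IntegrableOn φ (Set.Ioi 0) :=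
    integrableOn_besselI0_pow_mul_besselK0_pow (show a < m - a by omega) _
  have hder : ∀ t : ℝ, 0 < t → HasDerivAt
      (fun t => (sumRulePrimitive m k besselPencil besselPencilEuler m t).coeff a)
      (-(m.choose a / m.factorial) * φ t) t := fun t ht => by
    have h := hasPolyDerivAt_sumRulePrimitive k ht.ne' (hasPolyDerivAt_besselPencil ht)
      (hasPolyDerivAt_besselPencilEuler ht) m le_rfl a
    refine Eq.mp (congrArg (fun q => HasDerivAt _ q t) ?_) h
    rw [coeff_add, coeff_C_mul, coeff_C_mul, sub_self, zero_mul, zero_mul, zero_div, zero_mul,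
      add_zero, Nat.sub_self, pow_zero, mul_one, besselPencil,
      coeff_C_add_C_mul_X_pow _ _ (by omega), ← X_mul_sumRulePoly, map_mul, aeval_X, hφ]
    field_simp
  have h := integral_Ioi_zero_of_tendsto hder (hi.const_mul _)
    (tendsto_sumRulePrimitive_zero m k a) (tendsto_sumRulePrimitive_top k ha)
  rw [MeasureTheory.integral_const_mul] at h
  have hf : (m.factorial : ℝ) ≠ 0 := by positivity
  have hc : (m.choose a : ℝ) ≠ 0 := by
    have := Nat.choose_pos (show a ≤ m by omega)
    positivity
  split_ifs at h ⊢ with hka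
  · rw [hka.2, Nat.choose_zero_right] at h
    field_simp at h
    push_cast at h
    linarith
  · simpa [hf, hc] using h

/-! ### Rational dependence and dimension bounds -/

open Polynomial MeasureTheory in
/-- The rational linear functional `p ↦ ∫ I₀ ^ a K₀ ^ b t p(t ^ 2) dt`. -/
noncomputable def besselMoment {a b : ℕ} (hab : a < b) : ℚ[X] →ₗ[ℚ] ℝ where
  toFun p := ∫ t in Set.Ioi (0 : ℝ), besselI0 t ^ a * besselK0 t ^ b * t * aeval (t ^ 2) p
  map_add' p q := by
    rw [← integral_add (integrableOn_besselI0_pow_mul_besselK0_pow hab p)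
      (integrableOn_besselI0_pow_mul_besselK0_pow hab q)]
    simp only [map_add, mul_add]
  map_smul' c p := by
    rw [RingHom.id_apply, Rat.smul_def, ← integral_const_mul]
    congr 1
    funext t
    rw [map_smul, Rat.smul_def]
    ring

open Polynomial in
theorem besselMoment_X_pow {a b : ℕ} (hab : a < b) (k : ℕ) :
    besselMoment hab (X ^ k) = IKM a b (2 * k + 1) := by
  change ∫ t in Set.Ioi (0 : ℝ), besselI0 t ^ a * besselK0 t ^ b * t * aeval (t ^ 2) (X ^ k : ℚ[X]) =
    _
  rw [IKM]
  congr 1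
  funext t
  rw [map_pow, aeval_X]
  ring

open Polynomial in
theorem besselMoment_sumRulePoly {a b : ℕ} (hab : a < b) (k : ℕ) :
    besselMoment hab ((sumRulePoly (a + b) k).map (Int.castRingHom ℚ)) =
      if k = 0 ∧ a = 0 then (-1) ^ (a + b) * ((a + b).factorial : ℝ) else 0 := by
  rw [← integral_sumRulePoly k (show 2 * a < a + b by omega), Nat.add_sub_cancel_left]
  change ∫ t in Set.Ioi (0 : ℝ), besselI0 t ^ a * besselK0 t ^ b * t *
    aeval (t ^ 2) ((sumRulePoly (a + b) k).map (Int.castRingHom ℚ)) = _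
  congr 1
  funext t
  rw [show Int.castRingHom ℚ = algebraMap ℤ ℚ from rfl, aeval_map_algebraMap]

-- A relation of degree exactly N expresses the image of X^N through lower powers and `T`; strong
-- induction brings every power below d.
open Polynomial in
theorem map_X_pow_mem_span {K V : Type*} [Field K] [AddCommGroup V] [Module K V] [DecidableEq V]
    (Φ : K[X] →ₗ[K] V) (d : ℕ) (T : Finset V)
    (h : ∀ N, d ≤ N → ∃ p : K[X], p ≠ 0 ∧ p.natDegree = N ∧ Φ p ∈ Submodule.span K (T : Set V))
    (k : ℕ) : Φ (X ^ k) ∈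
      Submodule.span K (((Finset.range d).image (fun i => Φ (X ^ i)) ∪ T : Finset V) : Set V) := by
  induction k using Nat.strong_induction_on with
  | _ k ih =>
    rcases lt_or_ge k d with hk | hk
    · refine Submodule.subset_span ?_
      rw [Finset.mem_coe, Finset.mem_union, Finset.mem_image]
      exact Or.inl ⟨k, Finset.mem_range.2 hk, rfl⟩
    · obtain ⟨p, hp0, rfl, hp⟩ := h k hk
      have hc : p.leadingCoeff ≠ 0 := leadingCoeff_ne_zero.2 hp0
      have e := congrArg Φ p.as_sum_range_C_mul_X_pow
      simp only [← smul_eq_C_mul, map_sum, map_smul] at e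
      rw [Finset.sum_range_succ] at e
      rw [← Submodule.smul_mem_iff _ hc, leadingCoeff, eq_sub_of_add_eq' e.symm]
      refine Submodule.sub_mem _ (Submodule.span_mono ?_ hp) (Submodule.sum_mem _ fun i hi =>
        Submodule.smul_mem _ _ (ih i (Finset.mem_range.1 hi)))
      rw [Finset.coe_subset]
      exact Finset.subset_union_right

theorem not_linearIndependent_of_mem_span_finset {K V ι : Type*} [Field K] [AddCommGroup V]
    [Module K V] [Fintype ι] {S : Finset V} {v : ι → V} (hS : S.card < Fintype.card ι)
    (hv : ∀ i, v i ∈ Submodule.span K (S : Set V)) : ¬ LinearIndependent K v := fun hli => by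
  have := linearIndependent_le_span_aux' v hli (S : Set V) (by
    rintro _ ⟨i, rfl⟩
    exact hv i)
  simp at this
  omega

theorem exists_finset_IKM_mem_span {a b : ℕ} (hab : a < b) (hm : 2 ≤ a + b) (T : Finset ℝ)
    (hT : a = 0 → 1 ∈ T) : ∃ S : Finset ℝ, S.card ≤ (a + b - 1) / 2 + T.card ∧ T ⊆ S ∧
      ∀ k, IKM a b (2 * k + 1) ∈ Submodule.span ℚ (S : Set ℝ) := by
  classical
  refine ⟨(Finset.range ((a + b - 1) / 2)).image
    (fun i => besselMoment hab (Polynomial.X ^ i)) ∪ T, ?_, Finset.subset_union_right, fun k => ?_⟩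
  · refine (Finset.card_union_le _ _).trans (Nat.add_le_add_right ?_ _)
    simpa using Finset.card_image_le (s := Finset.range ((a + b - 1) / 2))
      (f := fun i => besselMoment hab (Polynomial.X ^ i))
  rw [← besselMoment_X_pow hab]
  refine map_X_pow_mem_span _ _ _ (fun N hN => ?_) k
  -- The starting exponent is chosen so that the relation has degree exactly N.
  refine ⟨(sumRulePoly (a + b) (N - (a + b - 1) / 2)).map (Int.castRingHom ℚ), ?_, ?_, ?_⟩
  · rw [Polynomial.map_ne_zero_iff (RingHom.injective_int _)]
    exact sumRulePoly_ne_zero hm _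
  · rw [Polynomial.natDegree_map_eq_of_injective (RingHom.injective_int _),
      natDegree_sumRulePoly hm]
    omega
  · rw [besselMoment_sumRulePoly]
    split_ifs with hc
    · have := Submodule.smul_mem (Submodule.span ℚ (T : Set ℝ))
        ((-1) ^ (a + b) * ((a + b).factorial : ℚ)) (Submodule.subset_span (hT hc.2))
      rw [Rat.smul_def] at this
      simpa using this
    · exact Submodule.zero_mem _

theorem rank_span_IKM_le {a b d : ℕ} {S : Finset ℝ} (hd : S.card ≤ d)
    (hS : ∀ k, IKM a b (2 * k + 1) ∈ Submodule.span ℚ (S : Set ℝ)) :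
    Module.rank ℚ (Submodule.span ℚ (Set.range fun k : ℕ => IKM a b (2 * k + 1))) ≤
      (d : Cardinal) := by
  refine (Submodule.rank_mono (t := Submodule.span ℚ (S : Set ℝ)) ?_).trans
    ((rank_span_finset_le S).trans (by exact_mod_cast hd))
  rw [Submodule.span_le]
  rintro _ ⟨k, rfl⟩
  exact hS k

theorem theorem2p1 :
    -- the Bessel moments with `a < b` are convergent integrals
    (∀ a b k : ℕ, a < b →
      MeasureTheory.IntegrableOn
        (fun t : ℝ => besselI0 t ^ a * besselK0 t ^ b * t ^ (2 * k + 1)) (Set.Ioi 0)) ∧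
    -- the sum rules
    (∀ n : ℕ, 1 ≤ n → ∃ f : Polynomial ℚ,
      f ≠ 0 ∧
      (∃ g : Polynomial ℤ,
        f = Polynomial.C (1 / ((n : ℚ) + 4)) * g.map (Int.castRingHom ℚ)) ∧
      f.natDegree ≤ (n + 1) / 2 ∧
      (MeasureTheory.IntegrableOn
          (fun t : ℝ => besselK0 t ^ (n + 2) * t * Polynomial.aeval (t ^ 2) f) (Set.Ioi 0) ∧
        ∫ t in Set.Ioi (0 : ℝ), besselK0 t ^ (n + 2) * t * Polynomial.aeval (t ^ 2) f
          = (Nat.factorial (n + 1) : ℝ)) ∧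
      (∀ a : ℕ, 1 ≤ a → 2 * a < n + 2 →
        MeasureTheory.IntegrableOn
          (fun t : ℝ => besselI0 t ^ a * besselK0 t ^ (n + 2 - a) * t *
            Polynomial.aeval (t ^ 2) f) (Set.Ioi 0) ∧
        ∫ t in Set.Ioi (0 : ℝ), besselI0 t ^ a * besselK0 t ^ (n + 2 - a) * t *
            Polynomial.aeval (t ^ 2) f = 0)) ∧
    -- linear dependence over `ℚ` and dimension bound when `1 ≤ a < b`
    (∀ a b : ℕ, 1 ≤ a → a < b →
      ¬ LinearIndependent ℚ
          (fun k : Fin ((a + b - 1) / 2 + 1) => IKM a b (2 * (k : ℕ) + 1)) ∧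
      Module.rank ℚ
          (Submodule.span ℚ (Set.range fun k : ℕ => IKM a b (2 * k + 1)))
        ≤ (((a + b - 1) / 2 : ℕ) : Cardinal)) ∧
    -- linear dependence over `ℚ` (together with `1`) and dimension bound when `a = 0`
    (∀ n : ℕ, 2 ≤ n →
      ¬ LinearIndependent ℚ
          (fun o : Option (Fin ((n - 1) / 2 + 1)) =>
            o.elim (1 : ℝ) (fun k => IKM 0 n (2 * (k : ℕ) + 1))) ∧
      Module.rank ℚ
          (Submodule.span ℚ (Set.range fun k : ℕ => IKM 0 n (2 * k + 1)))
        ≤ (((n + 1) / 2 : ℕ) : Cardinal)) := by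
  refine ⟨fun a b k hab => ?_, fun n hn => ?_, fun a b ha hab => ?_, fun n hn => ?_⟩
  · refine (integrableOn_besselI0_pow_mul_besselK0_pow hab
      (Polynomial.X ^ k : Polynomial ℤ)).congr_fun (fun t _ => ?_) measurableSet_Ioi
    simp only [map_pow, Polynomial.aeval_X]
    ring
  · obtain ⟨g, hg⟩ := C_dvd_sumRulePoly (n + 2)
    have hn4 : ((n : ℚ) + 4) ≠ 0 := by positivity
    have hn2' : ((n : ℝ) + 2) ≠ 0 := by positivity
    -- Here g is the polynomial for m = n + 2 divided by n + 2, so (n+2)! becomes (n+1)!; the sign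
    -- cancels (-1)^(n+2).
    set f : Polynomial ℚ := Polynomial.C ((-1) ^ n) * g.map (Int.castRingHom ℚ) with hf
    have hval : ∀ t : ℝ, Polynomial.aeval (t ^ 2) f =
        (-1) ^ n / (n + 2) * Polynomial.aeval (t ^ 2) (sumRulePoly (n + 2) 0) := fun t => by
      rw [hf, hg, map_mul, map_mul, Polynomial.aeval_C, Polynomial.aeval_C,
        show Int.castRingHom ℚ = algebraMap ℤ ℚ from rfl, Polynomial.aeval_map_algebraMap]
      simp
      field_simp
    have hint : ∀ a, 2 * a < n + 2 → ∫ t in Set.Ioi (0 : ℝ),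
        besselI0 t ^ a * besselK0 t ^ (n + 2 - a) * t * Polynomial.aeval (t ^ 2) f =
        if a = 0 then ((n + 1).factorial : ℝ) else 0 := fun a ha => by
      have h := integral_sumRulePoly 0 ha
      simp only [hval, mul_left_comm _ ((-1 : ℝ) ^ n / (n + 2))]
      rw [MeasureTheory.integral_const_mul, h]
      simp only [true_and]
      split_ifs
      · rw [Nat.factorial_succ (n + 1), pow_add]
        push_cast
        have : ((-1 : ℝ) ^ n) * (-1) ^ n = 1 := by rw [← mul_pow]; norm_num
        field_simp
        linear_combination ((n : ℝ) + 2) * this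
      · simp
    have hK := hint 0 (by omega)
    have hKi := integrableOn_besselI0_pow_mul_besselK0_pow (show 0 < n + 2 by omega) f
    simp only [pow_zero, one_mul, Nat.sub_zero, if_true] at hK hKi
    -- The coefficients of `f` are already integers; the factor n + 4 only compensates the
    -- prescribed denominator.
    refine ⟨f, ?_, ⟨Polynomial.C (((n : ℤ) + 4) * (-1) ^ n) * g, ?_⟩, ?_, ⟨hKi, hK⟩,
      fun a ha1 ha => ⟨integrableOn_besselI0_pow_mul_besselK0_pow (by omega) f, ?_⟩⟩
    -- If `f` were zero, its integral against K₀^(n+2) t could not be (n+1)!.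
    · intro h0
      rw [h0] at hK
      simp at hK
      exact absurd hK.symm (by positivity)
    · rw [hf, Polynomial.map_mul, Polynomial.map_C, ← mul_assoc, ← Polynomial.C_mul]
      congr 2
      simp
      field_simp
    · have hd := natDegree_sumRulePoly (show 2 ≤ n + 2 by omega) 0
      rw [hg, Polynomial.natDegree_C_mul (by positivity)] at hd
      rw [hf]
      refine (Polynomial.natDegree_C_mul_le _ _).trans (Polynomial.natDegree_map_le.trans ?_)
      omega
    · rw [hint a ha, if_neg (by omega)]
  · obtain ⟨S, hcard, -, hS⟩ := exists_finset_IKM_mem_span hab (by omega) ∅ (fun h => by omega)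
    rw [Finset.card_empty, add_zero] at hcard
    exact ⟨not_linearIndependent_of_mem_span_finset (by simpa using Nat.lt_succ_of_le hcard)
      fun i => hS i, rank_span_IKM_le hcard hS⟩
  · obtain ⟨S, hcard, hTS, hS⟩ := exists_finset_IKM_mem_span (show 0 < n by omega) (by omega) {1}
      (fun _ => Finset.mem_singleton_self 1)
    rw [Finset.card_singleton, zero_add] at hcard
    refine ⟨not_linearIndependent_of_mem_span_finset (S := S) ?_ ?_,
      rank_span_IKM_le (by omega) hS⟩
    · simp only [Fintype.card_option, Fintype.card_fin]
      omega
    · rintro (_ | k)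
      · exact Submodule.subset_span (hTS (Finset.mem_singleton_self 1))
      · exact hS k
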